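/- Let $R$ be a noetherian normal integral domain with field of fractions $K$, let $L/K$ be a finite separable field extension, let $S$ be the integral closure of $R$ in $L$, and let $\mathfrak{p}\in\operatorname{Spec} R$. Write $R_{\mathfrak{p}}$, $S_{\mathfrak{p}}$ for the localizations at $R\setminus\mathfrak{p}$, let $\operatorname{Tr}\colon S\to R$ be the restriction of the trace $\operatorname{Tr}_{L/K}$, let $\operatorname{Tr}_{\mathfrak{p}}\colon S_{\mathfrak{p}}\to R_{\mathfrak{p}}$ be its localization, and put $\mathfrak{p}^{\operatorname{Tr}}=\{s\in S : \operatorname{Tr}(sS)\subseteq\mathfrak{p}\}$. We say that $S/R$ is étale (resp. unramified) over $\mathfrak{p}$ if it is étale (resp. unramified) at every prime of $S$ lying over $\mathfrak{p}$. The extension $S_{\mathfrak{p}}/R_{\mathfrak{p}}$ is quasi-étale if its ramification divisor $\operatorname{Ram}$ is zero, where the coefficient of $\operatorname{Ram}$ at a height-one prime $Q$ of $S_{\mathfrak{p}}$ is the length over $(S_{\mathfrak{p}})_Q$ of the localization at $Q$ of the cokernel of the $S_{\mathfrak{p}}$-linear map $$\sigma\colon S_{\mathfrak{p}}\to\operatorname{Hom}_{R_{\mathfrak{p}}}(S_{\mathfrak{p}},R_{\mathfrak{p}}),\qquad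 s\mapsto \operatorname{Tr}_{\mathfrak{p}}(s\,\cdot\,).$$ The trace $\operatorname{Tr}_{\mathfrak{p}}$ is non-singular if $\sigma$ is an isomorphism. Then the following statements are equivalent: - (a) $S/R$ is étale over $\mathfrak{p}$; - (b) $S/R$ is unramified over $\mathfrak{p}$; - (c) $S_{\mathfrak{p}}/R_{\mathfrak{p}}$ is quasi-étale and flat; - (c$'$) $\operatorname{Tr}_{\mathfrak{p}}$ is non-singular and $S_{\mathfrak{p}}/R_{\mathfrak{p}}$ is flat; - (d) $\mathfrak{p}S_{\mathfrak{p}}=\mathfrak{p}^{\operatorname{Tr}}S_{\mathfrak{p}}$. If moreover $L/K$ is Galois, these statements are also equivalent to $e_{\mathfrak{p}}=1$, where $e_{\mathfrak{p}}$ is the order of the inertia group $I_{\mathfrak{q}}=\{\sigma\in\operatorname{Gal}(L/K) : \sigma(\mathfrak{q})=\mathfrak{q}\text{ and }\sigma\text{ acts trivially on }\kappa(\mathfrak{q})\}$ of a prime $\mathfrak{q}$ of $S$ lying over $\mathfrak{p}$ (this order does not depend on $\mathfrak{q}$). -/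

import Mathlib

noncomputable section

namespace TraceRamification

open scoped Pointwise

/-! ### Transposes of ideals and the ramification divisor of `T ∈ Hom_R(S, R)` -/

section Transpose

variable (R S : Type*) [CommRing R] [CommRing S] [Algebra R S]

/-- The module `ω_{S/R} = Hom_R(S, R)`. -/
def Omega : Type _ := S →ₗ[R] R

instance : AddCommGroup (Omega R S) := inferInstanceAs (AddCommGroup (S →ₗ[R] R))

variable {R S}

/-- The multiple `T · s ∈ ω_{S/R}`, that is `x ↦ T (s x)`. -/
def Omega.mulRight (T : S →ₗ[R] R) (s : S) : S →ₗ[R] R := T ∘ₗ LinearMap.mulLeft R s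

variable (R S)

/-- `ω_{S/R}` as an `S`-module: `(s • T) x = T (s x)`. -/
instance : Module S (Omega R S) where
  smul s T := Omega.mulRight T s
  one_smul T := LinearMap.ext fun x => congrArg (DFunLike.coe (F := S →ₗ[R] R) T) (one_mul x)
  mul_smul a b T := LinearMap.ext fun x =>
    congrArg (DFunLike.coe (F := S →ₗ[R] R) T) (by simp [mul_left_comm])
  smul_zero _ := rfl
  smul_add _ _ _ := rfl
  add_smul a b T := LinearMap.ext fun x =>
    (congrArg (DFunLike.coe (F := S →ₗ[R] R) T) (add_mul a b x)).trans (map_add _ _ _)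
  zero_smul T := LinearMap.ext fun x =>
    (congrArg (DFunLike.coe (F := S →ₗ[R] R) T) (zero_mul x)).trans (map_zero _)

variable {R S}

/-- The `T`-transpose of an ideal `a` of `R`: the ideal `{s ∈ S | T (s S) ⊆ a}` of `S`. -/
def transposeIdeal (T : S →ₗ[R] R) (a : Ideal R) : Ideal S where
  carrier := {s | ∀ x : S, T (s * x) ∈ a}
  add_mem' {s t} hs ht x := by
    have h : T ((s + t) * x) = T (s * x) + T (t * x) := by rw [add_mul, map_add]
    simpa only [h] using a.add_mem (hs x) (ht x)
  zero_mem' x := by simp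
  smul_mem' c s hs x := by
    have h : c • s * x = s * (c * x) := by rw [smul_eq_mul]; ring
    simpa only [h] using hs (c * x)

/-- `T` is non-singular if the `S`-linear map `S → ω_{S/R}`, `1 ↦ T`, is an isomorphism. -/
def IsNonSingular (T : S →ₗ[R] R) : Prop :=
  Function.Bijective (LinearMap.toSpanSingleton S (Omega R S) T)

/-- The coefficient of the ramification divisor `Ram_T` at a prime `Q` of `S` (of height one):
the length over `S_Q` of the localization at `Q` of the cokernel of `S → ω_{S/R}`, `1 ↦ T`. -/
def ramCoeff (T : S →ₗ[R] R) (Q : Ideal S) [Q.IsPrime] : ℕ∞ :=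
  Module.length (Localization.AtPrime Q)
    (LocalizedModule Q.primeCompl
      (Omega R S ⧸ LinearMap.range (LinearMap.toSpanSingleton S (Omega R S) T)))

/-- `Ram_T = 0`: the coefficient of the ramification divisor at every prime divisor of `Spec S`
vanishes. -/
def RamIsZero (T : S →ₗ[R] R) : Prop :=
  ∀ (Q : Ideal S) [Q.IsPrime], Q.height = 1 → ramCoeff T Q = 0

end Transpose

/-! ### Localization at a prime of the base -/

section AtPrime

variable {R : Type*} (S : Type*) [CommRing R] [CommRing S] [Algebra R S]
  (p : Ideal R) [p.IsPrime]

/-- The ring `S_𝔭`, the localization of `S` at the image of `R ∖ 𝔭`; it is an algebra over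
`R_𝔭 = Localization.AtPrime p`. -/
abbrev LocAt : Type _ := Localization (Algebra.algebraMapSubmonoid S p.primeCompl)

variable {S}

/-- The localization `T_𝔭 : S_𝔭 → R_𝔭` of `T : S → R`. -/
def locHom (T : S →ₗ[R] R) : LocAt S p →ₗ[Localization.AtPrime p] Localization.AtPrime p :=
  IsLocalizedModule.mapExtendScalars p.primeCompl
    ((IsScalarTower.toAlgHom R S (LocAt S p)).toLinearMap)
    (Algebra.linearMap R (Localization.AtPrime p)) (Localization.AtPrime p) T

/-- `T_𝔭 (s / 1) = T s / 1`. -/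
theorem locHom_algebraMap (T : S →ₗ[R] R) (s : S) :
    locHom p T (algebraMap S (LocAt S p) s) = algebraMap R (Localization.AtPrime p) (T s) :=
  IsLocalizedModule.map_apply p.primeCompl
    ((IsScalarTower.toAlgHom R S (LocAt S p)).toLinearMap)
    (Algebra.linearMap R (Localization.AtPrime p)) T s

variable (S)

/-- `S/R` is étale over `𝔭`: it is étale at every prime of `S` lying over `𝔭`. -/
def IsEtaleOver : Prop :=
  ∀ (q : Ideal S) [q.IsPrime], q.LiesOver p → Algebra.IsEtaleAt R q

/-- `S/R` is unramified over `𝔭`: it is unramified at every prime of `S` lying over `𝔭`. -/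
def IsUnramifiedOver : Prop :=
  ∀ (q : Ideal S) [q.IsPrime], q.LiesOver p → Algebra.IsUnramifiedAt R q

end AtPrime

/-! ### The trace and the ramification index of a separable normalization -/

/-- There is a prime of `S` over every prime of `R`. -/
theorem exists_prime_over (R K L S : Type*) [CommRing R] [CommRing S] [Field K] [Field L]
    [Algebra R K] [IsFractionRing R K] [Algebra K L] [Algebra R L] [IsScalarTower R K L]
    [Algebra R S] [Algebra S L] [IsScalarTower R S L] [IsIntegralClosure S R L]
    (p : Ideal R) [p.IsPrime] :
    ∃ q : Ideal S, q.IsPrime ∧ q.LiesOver p := by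
  have hi : Algebra.IsIntegral R S := IsIntegralClosure.isIntegral_algebra R L
  have hf : FaithfulSMul R S := by
    rw [faithfulSMul_iff_algebraMap_injective]
    have h1 : Function.Injective (algebraMap R L) := by
      rw [IsScalarTower.algebraMap_eq R K L]
      exact (algebraMap K L).injective.comp (IsFractionRing.injective R K)
    rw [IsScalarTower.algebraMap_eq R S L] at h1
    exact Function.Injective.of_comp h1
  obtain ⟨q, hq, h⟩ := Ideal.nonempty_primesOver (S := S) p
  exact ⟨q, hq, h⟩

section Normalization

variable (R K L S : Type*) [CommRing R] [CommRing S] [Field K] [Field L]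
  [Algebra R K] [IsFractionRing R K] [Algebra K L] [Algebra R L] [IsScalarTower R K L]
  [Algebra R S] [Algebra S L] [IsScalarTower R S L] [IsIntegralClosure S R L]
  [FiniteDimensional K L]

/-- The inertia group of a prime `q` of `S`: those `σ ∈ Gal(L/K)` with `σ s - s ∈ q` for all `s`.
Such `σ` map `q` onto itself (`map_eq_of_mem_inertiaGroup`), so that this is the subgroup of the
decomposition group of `q` acting trivially on `S / q`, equivalently on its fraction field `κ(q)`. -/
def inertiaGroup (q : Ideal S) : Subgroup (Gal(L/K)) :=
  letI := MulSemiringAction.compHom S (galRestrict R K L S).toMonoidHom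
  q.inertia (Gal(L/K))

theorem mem_inertiaGroup {q : Ideal S} {σ : Gal(L/K)} :
    σ ∈ inertiaGroup R K L S q ↔ ∀ s : S, galRestrict R K L S σ s - s ∈ q := Iff.rfl

theorem map_eq_of_mem_inertiaGroup {q : Ideal S} {σ : Gal(L/K)}
    (h : σ ∈ inertiaGroup R K L S q) : q.map (galRestrict R K L S σ) = q := by
  have key : ∀ τ ∈ inertiaGroup R K L S q, q.map (galRestrict R K L S τ) ≤ q := by
    intro τ hτ
    rw [Ideal.map_le_iff_le_comap]
    intro s hs
    have h := q.add_mem ((mem_inertiaGroup R K L S).1 hτ s) hs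
    rwa [sub_add_cancel] at h
  refine le_antisymm (key σ h) fun s hs => ?_
  have h1 : galRestrict R K L S σ⁻¹ s ∈ q :=
    key _ (inv_mem h) (Ideal.mem_map_of_mem _ hs)
  have h2 := Ideal.mem_map_of_mem (galRestrict R K L S σ) h1
  have h3 : galRestrict R K L S σ (galRestrict R K L S σ⁻¹ s) = s := by
    rw [map_inv]
    exact (galRestrict R K L S σ).apply_symm_apply s
  rwa [h3] at h2

/-- The ramification index `e_𝔭` of `S/R` over `𝔭`: the order of the inertia group of a prime
of `S` over `𝔭`. If `L/K` is Galois it does not depend on the prime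
(`ramificationIndex_eq`). -/
def ramificationIndex (p : Ideal R) [p.IsPrime] : ℕ :=
  Nat.card (inertiaGroup R K L S (exists_prime_over R K L S p).choose)

variable [IsIntegrallyClosed R]

/-- The trace `Tr_{S/R} : S → R`, the restriction of the trace of `L/K`. -/
def traceHom : S →ₗ[R] R := Algebra.intTraceAux R K L S

/-- `Tr_{S/R}` is the restriction of the trace of `L/K`. -/
theorem algebraMap_traceHom (s : S) :
    algebraMap R K (traceHom R K L S s) = Algebra.trace K L (algebraMap S L s) :=
  Algebra.map_intTraceAux s

/-- The inertia groups of any two primes over `𝔭` have the same order when `L/K` is Galois. -/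
theorem ramificationIndex_eq [IsGalois K L] (p : Ideal R) [p.IsPrime] (q : Ideal S) [q.IsPrime]
    [q.LiesOver p] : ramificationIndex R K L S p = Nat.card (inertiaGroup R K L S q) := by
  obtain ⟨hq₀, hp₀⟩ := (exists_prime_over R K L S p).choose_spec
  unfold ramificationIndex
  set q₀ := (exists_prime_over R K L S p).choose
  have : IsDomain R := (IsFractionRing.injective R K).isDomain
  have : IsDomain S := (IsIntegralClosure.equiv R S L (integralClosure R L)).toMulEquiv.isDomain _
  have := IsIntegralClosure.isFractionRing_of_finite_extension R K L S
  let := IsIntegralClosure.MulSemiringAction R K L S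
  have := Algebra.isInvariant_of_isGalois R K L S
  have : SMulCommClass (Gal(L/K)) R S := ⟨fun g a s => map_smul (galRestrict R K L S g) a s⟩
  obtain ⟨g, hg⟩ := Algebra.IsInvariant.exists_smul_of_under_eq R S (Gal(L/K)) q₀ q
    ((q₀.over_def p).symm.trans (q.over_def p))
  refine Nat.card_congr ((MulAut.conj g).toEquiv.subtypeEquiv fun σ => ?_)
  change (∀ s : S, σ • s - s ∈ q₀) ↔ ∀ s : S, (g * σ * g⁻¹) • s - s ∈ q
  have key : ∀ s : S, (g * σ * g⁻¹) • s - s = g • (σ • (g⁻¹ • s) - g⁻¹ • s) := by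
    intro s
    rw [smul_sub, smul_inv_smul, mul_smul, mul_smul]
  simp only [key, hg, Ideal.smul_mem_pointwise_smul_iff]
  exact ⟨fun h s => h _, fun h s => by simpa using h (g • s)⟩

end Normalization

end TraceRamification

end

/-! Write A = R_𝔭 and B = S_𝔭. Since L/K is separable, B is finite over the local ring A, so flat
means free. All conditions are compared with (c'), which says that B has an A-basis b whose Gram
matrix (Tr(b_i b_j)) is invertible.

If it is invertible, there is a trace-dual basis d. Then ∑ b_i ⊗ d_i is a separability element, so
B/A is unramified, and étale by flatness (`IsNonSingular.formallyUnramified`). Expanding in d also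
puts the transpose of the maximal ideal 𝔪 inside 𝔪B.

A Gram determinant that is not a unit is detected in two ways. A kernel vector modulo 𝔪 is an
element of the transpose ideal outside 𝔪B (`isNonSingular_of_transposeIdeal_le`). If B is free, a
minimal prime over the determinant has a height-one prime above it in the support of Ram
(`isNonSingular_of_ramIsZero`).

For (b) and for inertia, the Gram matrix is factored as MᵗM with M = (τ b_j), where τ runs over the
embeddings of L. By Dedekind's independence of characters some choice of b makes det M nonzero in a
field F, provided that the embeddings stay distinct after reduction to F
(`isNonSingular_of_injective`). In the unramified case F ⊗ B = F^r with r ≥ [L:K], and each of the r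
points is the reduction of an embedding (`exists_eq_comp_galRestrict'`). In the Galois case, two
automorphisms with the same reduction at 𝔮 differ by an element of I_𝔮. Conversely, unramifiedness
kills inertia by Krull's intersection theorem. -/

namespace TraceRamification

open Module

/-! ### Gram matrices and dual bases -/

section Dual

variable {A B : Type*} [CommRing A] [CommRing B] [Algebra A B]

theorem isNonSingular_iff {T : B →ₗ[A] A} :
    IsNonSingular T ↔ (∀ s, (∀ x, T (s * x) = 0) → s = 0) ∧
      ∀ φ : B →ₗ[A] A, ∃ s, ∀ x, T (s * x) = φ x := by
  refine and_congr ?_ ⟨fun h φ => ?_, fun h φ => ?_⟩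
  · rw [injective_iff_map_eq_zero]
    exact forall_congr' fun s => imp_congr_left ⟨fun h x => LinearMap.congr_fun h x,
      fun h => LinearMap.ext (σ := RingHom.id A) h⟩
  · obtain ⟨s, hs⟩ := h φ
    exact ⟨s, fun x => LinearMap.congr_fun hs x⟩
  · obtain ⟨s, hs⟩ := h φ
    exact ⟨s, LinearMap.ext (σ := RingHom.id A) hs⟩

variable {ι : Type*} [Fintype ι] [DecidableEq ι] {T : B →ₗ[A] A} {b : ι → B}

theorem exists_pairing_eq (hu : IsUnit (Matrix.of fun i j => T (b i * b j)).det) (f : ι → A) :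
    ∃ c : ι → A, ∀ j, T ((∑ i, c i • b i) * b j) = f j := by
  set M : Matrix ι ι A := Matrix.of fun i j => T (b i * b j)
  refine ⟨Matrix.vecMul f M⁻¹, fun j => ?_⟩
  have h : Matrix.vecMul (Matrix.vecMul f M⁻¹) M = f := by
    rw [Matrix.vecMul_vecMul, Matrix.nonsing_inv_mul _ hu, Matrix.vecMul_one]
  conv_rhs => rw [← h]
  simp [Finset.sum_mul, Matrix.vecMul, dotProduct, M]

theorem linearIndependent_of_isUnit_det
    (hu : IsUnit (Matrix.of fun i j => T (b i * b j)).det) : LinearIndependent A b := by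
  rw [Fintype.linearIndependent_iff]
  intro c hc
  have h : Matrix.vecMul c (Matrix.of fun i j => T (b i * b j)) = 0 := by
    ext j
    simpa [Finset.sum_mul, Matrix.vecMul, dotProduct] using congrArg (fun x => T (x * b j)) hc
  have h2 := congrArg (fun v => Matrix.vecMul v (Matrix.of fun i j => T (b i * b j))⁻¹) h
  simp only [Matrix.vecMul_vecMul, Matrix.mul_nonsing_inv _ hu, Matrix.vecMul_one,
    Matrix.zero_vecMul] at h2
  exact fun i => congrFun h2 i

/-- Inverting the Gram matrix yields a combination of the `b i` with the same pairings as a given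
`x`. The difference is orthogonal to every `b i`, hence zero, so `b` spans. -/
theorem isNonSingular_of_isUnit_det_of_forall
    (hu : IsUnit (Matrix.of fun i j => T (b i * b j)).det)
    (ho : ∀ x, (∀ i, T (x * b i) = 0) → x = 0) :
    IsNonSingular T ∧ Nonempty (Basis ι A B) := by
  refine ⟨isNonSingular_iff.2 ⟨fun s hs => ho s fun i => hs _, fun φ => ?_⟩,
    ⟨Basis.mk (linearIndependent_of_isUnit_det hu) fun x _ => ?_⟩⟩
  · have hs : ∀ x, ∃ c : ι → A, x = ∑ i, c i • b i := fun x => by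
      obtain ⟨c, hc⟩ := exists_pairing_eq hu fun j => T (x * b j)
      exact ⟨c, sub_eq_zero.1 (ho _ fun i => by rw [sub_mul, map_sub, hc, sub_self])⟩
    obtain ⟨c, hc⟩ := exists_pairing_eq hu fun j => φ (b j)
    refine ⟨∑ i, c i • b i, fun x => ?_⟩
    obtain ⟨a, rfl⟩ := hs x
    rw [Finset.mul_sum, map_sum, map_sum]
    exact Finset.sum_congr rfl fun i _ => by rw [mul_smul_comm, map_smul, map_smul, hc]
  · obtain ⟨c, hc⟩ := exists_pairing_eq hu fun j => T (x * b j)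
    rw [sub_eq_zero.1 (ho (x - ∑ i, c i • b i) fun i => by rw [sub_mul, map_sub, hc, sub_self])]
    exact Submodule.sum_mem _ fun i _ => Submodule.smul_mem _ _ (Submodule.subset_span ⟨i, rfl⟩)

omit [Fintype ι] in
theorem IsNonSingular.exists_dual (hT : IsNonSingular T) (b : Basis ι A B) :
    ∃ d : ι → B, ∀ i j, T (d i * b j) = if i = j then 1 else 0 := by
  choose d hd using fun i => (isNonSingular_iff.1 hT).2 (b.coord i)
  exact ⟨d, fun i j => by rw [hd, Basis.coord_apply, Basis.repr_self, Finsupp.single_apply]; simp [eq_comm]⟩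

theorem IsNonSingular.sum_smul_dual (hT : IsNonSingular T) (b : Basis ι A B) {d : ι → B}
    (hd : ∀ i j, T (d i * b j) = if i = j then 1 else 0) (s : B) :
    s = ∑ i, T (s * b i) • d i := by
  refine sub_eq_zero.1 ((isNonSingular_iff.1 hT).1 _ fun x => ?_)
  have : T ∘ₗ LinearMap.mulLeft A (s - ∑ i, T (s * b i) • d i) = 0 :=
    b.ext fun j => by simp [sub_mul, Finset.sum_mul, hd]
  exact LinearMap.congr_fun this x

theorem IsNonSingular.transposeIdeal_le [Module.Free A B] [Module.Finite A B]
    (hT : IsNonSingular T) (m : Ideal A) : transposeIdeal T m ≤ m.map (algebraMap A B) := by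
  intro s hs
  obtain ⟨d, hd⟩ := hT.exists_dual (Module.Free.chooseBasis A B)
  rw [hT.sum_smul_dual _ hd s]
  refine Ideal.sum_mem _ fun i _ => ?_
  rw [Algebra.smul_def]
  exact Ideal.mul_mem_right _ _ (Ideal.mem_map_of_mem _ (hs _))

theorem sum_trace_dual_smul (b : Basis ι A B) {d : ι → B}
    (hd : ∀ i j, T (d i * b j) = if i = j then 1 else 0) (x : B) :
    x = ∑ j, T (d j * x) • b j := by
  have : LinearMap.id = ∑ j, (T ∘ₗ LinearMap.mulLeft A (d j)).smulRight (b j) :=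
    b.ext fun j => by
      simp only [LinearMap.id_apply, LinearMap.sum_apply, LinearMap.smulRight_apply,
        LinearMap.comp_apply, LinearMap.mulLeft_apply, hd, ite_smul, one_smul, zero_smul,
        Finset.sum_ite_eq', Finset.mem_univ, if_true]
  simpa using LinearMap.congr_fun this x

/-- The separability element is `∑ b i ⊗ d i`. Expanding `s * d i` in `d` and `s * b i` in `b` gives
the same coefficients, so the two actions of `s` on it agree. -/
theorem IsNonSingular.formallyUnramified [Module.Free A B] [Module.Finite A B]
    (hT : IsNonSingular (Algebra.trace A B)) : Algebra.FormallyUnramified A B := by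
  classical
  set b := Module.Free.chooseBasis A B
  obtain ⟨d, hd⟩ := hT.exists_dual b
  have hs := hT.sum_smul_dual b hd
  rw [Algebra.FormallyUnramified.iff_exists_tensorProduct]
  refine ⟨∑ i, b i ⊗ₜ[A] d i, fun s => ?_, ?_⟩
  · rw [sub_mul, sub_eq_zero, Finset.mul_sum, Finset.mul_sum]
    simp only [Algebra.TensorProduct.tmul_mul_tmul, one_mul]
    have h1 : ∀ i, s * d i = ∑ j, Algebra.trace A B (s * d i * b j) • d j := fun i => hs _
    have h2 : ∀ i, s * b i = ∑ j, Algebra.trace A B (d j * (s * b i)) • b j :=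
      fun i => sum_trace_dual_smul b hd _
    trans ∑ i, ∑ j, Algebra.trace A B (s * d i * b j) • b i ⊗ₜ[A] d j
    · refine Finset.sum_congr rfl fun i _ => ?_
      conv_lhs => rw [h1 i, TensorProduct.tmul_sum]
      simp only [TensorProduct.tmul_smul]
    · rw [Finset.sum_comm]
      refine Finset.sum_congr rfl fun j _ => ?_
      conv_rhs => rw [h2 j, TensorProduct.sum_tmul]
      refine Finset.sum_congr rfl fun i _ => ?_
      rw [TensorProduct.smul_tmul', mul_comm s (d i), mul_assoc]
  · simp only [map_sum, Algebra.TensorProduct.lmul'_apply_tmul]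
    -- `Tr(d i * (x * b i))` is the `i`-th diagonal entry of multiplication by `x`. The sum over `i`
    -- is `Tr x`, so `∑ b i * d i` pairs like `1`.
    refine sub_eq_zero.1 ((isNonSingular_iff.1 hT).1 _ fun x => ?_)
    rw [sub_mul, one_mul, map_sub, sub_eq_zero, Algebra.trace_eq_matrix_trace b x,
      Matrix.trace, Finset.sum_mul, map_sum]
    refine Finset.sum_congr rfl fun i _ => ?_
    rw [Matrix.diag_apply, Algebra.leftMulMatrix_eq_repr_mul,
      show b i * d i * x = d i * (x * b i) by ring]
    conv_rhs => rw [sum_trace_dual_smul b hd (x * b i), b.repr_sum_self]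

end Dual

/-! ### The transpose ideal over a local base -/

section LocalBase

variable {A B : Type*} [CommRing A] [IsLocalRing A] [CommRing B] [Algebra A B] [Module.Finite A B]
  {T : B →ₗ[A] A}

open IsLocalRing TensorProduct in
-- Lifts `f` of a basis of `B/𝔪B` generate `B` by Nakayama. A kernel vector of their Gram matrix
-- modulo 𝔪 lifts to an element of the transpose ideal, hence of `𝔪B`, so it is zero modulo 𝔪.
theorem isNonSingular_of_transposeIdeal_le (hT : ∀ s, (∀ x, T (s * x) = 0) → s = 0)
    (h : transposeIdeal T (maximalIdeal A) ≤ (maximalIdeal A).map (algebraMap A B)) :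
    IsNonSingular T ∧ Module.Free A B := by
  classical
  set w := Free.chooseBasis (ResidueField A) (ResidueField A ⊗[A] B)
  obtain ⟨f, hf⟩ := (TensorProduct.mk_surjective A B (ResidueField A)
    Ideal.Quotient.mk_surjective).comp_left w
  have hf' : ∀ i, 1 ⊗ₜ f i = w i := congrFun hf
  have hspan := span_eq_top_of_tmul_eq_basis f w hf'
  have hT' : ∀ s, (∀ i, T (s * f i) = 0) → s = 0 := fun s hs => hT s fun x => by
    have : T ∘ₗ LinearMap.mulLeft A s = 0 :=
      LinearMap.ext_on_range hspan fun i => hs i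
    exact LinearMap.congr_fun this x
  have hu : IsUnit (Matrix.of fun i j => T (f i * f j)).det := by
    rw [← residue_ne_zero_iff_isUnit, RingHom.map_det]
    intro h0
    obtain ⟨v, hv0, hv⟩ := Matrix.exists_vecMul_eq_zero_iff.2 h0
    obtain ⟨c, rfl⟩ := (residue_surjective (R := A)).comp_left v
    refine hv0 (funext fun i => ?_)
    have hs : ∑ i, c i • f i ∈ transposeIdeal T (maximalIdeal A) := fun x => by
      have hx : x ∈ Submodule.span A (Set.range f) := hspan ▸ Submodule.mem_top
      induction hx using Submodule.span_induction with
      | mem x hx =>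
        obtain ⟨j, rfl⟩ := hx
        rw [← residue_eq_zero_iff]
        simpa [Finset.sum_mul, Matrix.vecMul, dotProduct] using congrFun hv j
      | zero => simp
      | add x y _ _ hx hy => rw [mul_add, map_add]; exact add_mem hx hy
      | smul a x _ hx => rw [mul_smul_comm, map_smul]; exact Ideal.mul_mem_left _ _ hx
    have h1 : ∀ s ∈ (maximalIdeal A).map (algebraMap A B), (1 : ResidueField A) ⊗ₜ[A] s = 0 := by
      intro s hs
      rw [← Submodule.restrictScalars_mem A, ← Ideal.smul_top_eq_map] at hs
      induction hs using Submodule.smul_induction_on' with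
      | smul a ha x _ =>
        rw [← TensorProduct.smul_tmul, Algebra.smul_def, ResidueField.algebraMap_eq,
          (residue_eq_zero_iff a).2 ha, zero_mul, zero_tmul]
      | add x _ y _ hx hy => rw [tmul_add, hx, hy, add_zero]
    have h2 := h1 _ (h hs)
    simp only [tmul_sum, ← TensorProduct.smul_tmul] at h2
    have h3 : ∀ i, (c i • (1 : ResidueField A)) ⊗ₜ[A] f i = residue A (c i) • w i := fun i => by
      rw [← hf', TensorProduct.smul_tmul', Algebra.smul_def, smul_eq_mul, ResidueField.algebraMap_eq]
    simp only [h3] at h2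
    exact Fintype.linearIndependent_iff.1 w.linearIndependent _ h2 i
  obtain ⟨h1, ⟨b⟩⟩ := isNonSingular_of_isUnit_det_of_forall hu hT'
  exact ⟨h1, .of_basis b⟩

end LocalBase

end TraceRamification

namespace TraceRamification

open Module

/-! ### Vanishing of the ramification divisor -/

section Ramification

variable {A B : Type*} [CommRing A] [CommRing B] [Algebra A B]

theorem height_eq_one_of_liesOver [IsDomain A] [IsDomain B] [Algebra.IsIntegral A B] [FaithfulSMul A B] {P : Ideal A}
    [P.IsPrime] {Q : Ideal B} [Q.IsPrime] (hQ : Q.comap (algebraMap A B) = P) (hP : P.height ≤ 1)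
    (hP0 : P ≠ ⊥) : Q.height = 1 := by
  refine le_antisymm ?_ (Order.one_le_iff_ne_zero.2 fun h => hP0 ?_)
  · rw [← Nat.cast_one, Ideal.height_le_iff]
    intro q hq hlt
    have h1 : q.comap (algebraMap A B) < P := hQ ▸ Ideal.IsIntegral.comap_lt_comap hlt
    have h2 := (Ideal.height_le_iff (n := 1)).1 (by simpa using hP) _ inferInstance h1
    rw [Nat.cast_one, Order.lt_one_iff, Ideal.height_eq_zero_iff_eq_bot] at h2
    rw [Ideal.eq_bot_of_comap_eq_bot h2]
    simp
  · rw [← hQ, Ideal.height_eq_zero_iff_eq_bot.1 h]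
    exact Ideal.comap_bot_of_injective _ (FaithfulSMul.algebraMap_injective A B)

/-- An element of `ω_{B/A}` as a linear form. -/
def Omega.toHom : Omega A B ≃+ (B →ₗ[A] A) := AddEquiv.refl _

theorem Omega.toHom_smul (s : B) (φ : Omega A B) (x : B) :
    Omega.toHom (s • φ) x = Omega.toHom φ (s * x) := rfl

/-- Finiteness over `B` makes the support of the cokernel of σ the zero locus of its annihilator. -/
theorem finite_omega [Module.Free A B] [Module.Finite A B] : Module.Finite B (Omega A B) := by
  classical
  let b := Free.chooseBasis A B
  refine ⟨⟨Finset.univ.image fun i => Omega.toHom.symm (b.coord i), eq_top_iff.2 fun φ _ => ?_⟩⟩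
  have h : φ = ∑ i, algebraMap A B (Omega.toHom φ (b i)) • Omega.toHom.symm (b.coord i) := by
    refine Omega.toHom.injective (b.ext fun j => ?_)
    simp [Omega.toHom_smul, ← Algebra.smul_def, Finsupp.single_apply]
  rw [h]
  exact Submodule.sum_mem _ fun i _ => Submodule.smul_mem _ _
    (Submodule.subset_span (by simp))

/-- If the Gram determinant is not a unit, Krull's principal ideal theorem gives a prime `P` of
height at most one containing it. No prime above `P` supports the cokernel, so by lying over some `a
∉ P` kills the cokernel. -/
theorem isNonSingular_of_ramIsZero [IsDomain A] [IsDomain B] [IsNoetherianRing A] [Module.Free A B] [Module.Finite A B]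
    {T : B →ₗ[A] A}
    (hT : ∀ s, (∀ x, T (s * x) = 0) → s = 0) (h : RamIsZero T) : IsNonSingular T := by
  classical
  let b := Free.chooseBasis A B
  set M := Matrix.of fun i j => T (b i * b j) with hM
  have hT' : ∀ s, (∀ i, T (s * b i) = 0) → s = 0 := fun s hs => hT s fun x => by
    have : T ∘ₗ LinearMap.mulLeft A s = 0 := b.ext hs
    exact LinearMap.congr_fun this x
  have hv : ∀ (v : _ → A) j, Matrix.vecMul v M j = T ((∑ i, v i • b i) * b j) := fun v j => by
    simp [Matrix.vecMul, dotProduct, Finset.sum_mul, hM]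
  by_cases hu : IsUnit M.det
  · exact (isNonSingular_of_isUnit_det_of_forall hu hT').1
  have hd : M.det ≠ 0 := fun h0 => by
    obtain ⟨v, hv0, hv1⟩ := Matrix.exists_vecMul_eq_zero_iff.2 h0
    have := hT' (∑ i, v i • b i) fun j => by rw [← hv, hv1, Pi.zero_apply]
    exact hv0 (funext (Fintype.linearIndependent_iff.1 b.linearIndependent v this))
  obtain ⟨P, hP⟩ := Ideal.nonempty_minimalPrimes (I := Ideal.span {M.det})
    (by rwa [Ne, Ideal.span_singleton_eq_top])
  have := hP.1.1
  have hdP : M.det ∈ P := hP.1.2 (Ideal.mem_span_singleton_self _)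
  have hP1 := Ideal.height_le_one_of_isPrincipal_of_mem_minimalPrimes _ P hP
  have hP0 : P ≠ ⊥ := fun h0 => hd (by simpa [h0] using hdP)
  have := finite_omega (A := A) (B := B)
  set I := Module.annihilator B
    (Omega A B ⧸ LinearMap.range (LinearMap.toSpanSingleton B (Omega A B) T))
  by_cases hI : I.comap (algebraMap A B) ≤ P
  · obtain ⟨Q, hIQ, hQ, hQP⟩ := Ideal.exists_ideal_over_prime_of_isIntegral P I hI
    have h1 := h Q (height_eq_one_of_liesOver hQP hP1 hP0)
    rw [ramCoeff, Module.length_eq_zero_iff] at h1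
    have h2 : (⟨Q, hQ⟩ : PrimeSpectrum B) ∉ Module.support B
      (Omega A B ⧸ LinearMap.range (LinearMap.toSpanSingleton B (Omega A B) T)) := by
      rwa [Module.notMem_support_iff]
    exact absurd (Module.mem_support_iff_of_finite.2 hIQ) h2
  · obtain ⟨a, haI, haP⟩ := SetLike.not_le_iff_exists.1 hI
    rw [Ideal.mem_comap, Module.mem_annihilator] at haI
    have h1 : ∀ j, ∃ s : B, ∀ x, T (s * x) = a * b.coord j x := fun j => by
      have := haI (Submodule.Quotient.mk (Omega.toHom.symm (b.coord j)))
      rw [← Submodule.Quotient.mk_smul, Submodule.Quotient.mk_eq_zero] at this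
      obtain ⟨s, hs⟩ := this
      refine ⟨s, fun x => (LinearMap.congr_fun (σ := RingHom.id A) hs x).trans ?_⟩
      refine (Omega.toHom_smul (algebraMap A B a) (Omega.toHom.symm (b.coord j)) x).trans ?_
      rw [← Algebra.smul_def, map_smul, smul_eq_mul]
      rfl
    choose s hs using h1
    -- The form of `s j` is `a` times the `j`-th coordinate. Taking determinants shows that `M.det`
    -- divides a power of `a`, which forces `a ∈ P`.
    have h2 : Matrix.of (fun j i => b.repr (s j) i) * M = a • 1 := by
      ext j k
      rw [Matrix.mul_apply_eq_vecMul, hv]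
      simp [b.sum_repr, hs, Matrix.one_apply, Finsupp.single_apply, eq_comm]
    have h3 := congrArg Matrix.det h2
    rw [Matrix.det_mul, Matrix.det_smul, Matrix.det_one, mul_one] at h3
    exact absurd (Ideal.IsPrime.mem_of_pow_mem ‹_› _ (h3 ▸ P.mul_mem_left _ hdP)) haP

theorem IsNonSingular.ramIsZero {T : B →ₗ[A] A} (hT : IsNonSingular T) : RamIsZero T := by
  intro Q _ _
  rw [ramCoeff, Module.length_eq_zero_iff, LinearMap.range_eq_top.2 hT.2]
  infer_instance

end Ramification

end TraceRamification

/-! ### Embeddings and their reductions -/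

namespace TraceRamification

open Module Polynomial

/-- A functional vanishing on all vectors `(χ i x)_i` is a linear relation among the `χ i`. These
vectors therefore span, and a basis can be chosen among them. -/
theorem exists_det_ne_zero_of_linearIndependent {ι X F : Type*} [Fintype ι] [DecidableEq ι]
    [Field F] {χ : ι → X → F} (h : LinearIndependent F χ) :
    ∃ b : ι → X, (Matrix.of fun i j => χ i (b j)).det ≠ 0 := by
  let v : X → ι → F := fun x i => χ i x
  have hspan : Submodule.span F (Set.range v) = ⊤ := by
    by_contra hne
    obtain ⟨f, hf0, hf⟩ := Submodule.exists_le_ker_of_lt_top _ (lt_top_iff_ne_top.2 hne)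
    refine hf0 (LinearMap.pi_ext' fun i => LinearMap.ext_ring ?_)
    refine Fintype.linearIndependent_iff.1 h (fun i => f (Pi.single i 1)) (funext fun x => ?_) i
    have h1 : f (v x) = 0 := hf (Submodule.subset_span ⟨x, rfl⟩)
    rw [LinearMap.pi_apply_eq_sum_univ f] at h1
    have h2 : ∀ i : ι, (fun j => if i = j then (1 : F) else 0) = Pi.single i 1 := fun i =>
      funext fun j => by simp [Pi.single_apply, eq_comm]
    simpa [v, mul_comm, h2] using h1
  obtain ⟨κ, a, -, ha, hli⟩ := exists_linearIndependent' F v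
  let B := Basis.mk hli (ha.trans hspan).ge
  let e := B.indexEquiv (Pi.basisFun F ι)
  refine ⟨fun i => a (e.symm i), ?_⟩
  have h2 : LinearIndependent F (fun i => v (a (e.symm i))) := hli.comp _ e.symm.injective
  rw [← Matrix.det_transpose, ← isUnit_iff_ne_zero, ← Matrix.isUnit_iff_isUnit_det,
    ← Matrix.linearIndependent_rows_iff_isUnit]
  exact h2

section Embeddings

variable {K L N : Type*} [Field K] [Field L] [Field N] [Algebra K L] [Algebra K N]
  [FiniteDimensional K L] [Algebra.IsSeparable K L]

theorem trace_eq_sum_embeddings_of_splits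
    (hs : ∀ x : L, ((minpoly K x).map (algebraMap K N)).Splits) (x : L) :
    algebraMap K N (Algebra.trace K L x) = ∑ τ : L →ₐ[K] N, τ x := by
  classical
  have h1 := trace_eq_sum_embeddings (K := K) (AlgebraicClosure N) (x := x)
  have h2 : Function.Bijective fun τ : L →ₐ[K] N =>
      (IsScalarTower.toAlgHom K N (AlgebraicClosure N)).comp τ := by
    rw [Fintype.bijective_iff_injective_and_card, AlgHom.card_of_splits _ _ _ hs, AlgHom.card]
    -- Both sides count `[L:K]` embeddings, so every embedding into the algebraic closure already
    -- lands in `N`.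
    exact ⟨fun τ τ' h => AlgHom.ext fun y => (algebraMap N (AlgebraicClosure N)).injective
      (AlgHom.congr_fun h y), rfl⟩
  refine (algebraMap N (AlgebraicClosure N)).injective ?_
  rw [← IsScalarTower.algebraMap_apply, h1, map_sum]
  exact (Fintype.sum_bijective _ h2 _ _ fun τ => rfl).symm

end Embeddings

section Conjugates

variable {A K L N B C : Type*} [CommRing A] [IsIntegrallyClosed A] [Field K] [Algebra A K]
  [IsFractionRing A K] [Field L] [Algebra K L] [Algebra A L] [IsScalarTower A K L]
  [FiniteDimensional K L] [Algebra.IsSeparable K L]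
  [Field N] [Algebra K N] [Algebra A N] [IsScalarTower A K N]
  [CommRing B] [Algebra A B] [Algebra B L] [IsScalarTower A B L] [IsIntegralClosure B A L]
  [CommRing C] [Algebra A C] [Algebra C N] [IsScalarTower A C N] [IsIntegralClosure C A N]
  (hs : ∀ x : L, ((minpoly K x).map (algebraMap K N)).Splits)
include hs

omit [IsIntegrallyClosed A] [IsFractionRing A K] in
open Classical in
-- Distinct ring homomorphisms `B → F` are linearly independent by Dedekind. The Gram matrix becomes
-- `Mᵗ M` over `C`, and locality of `A → F` turns a nonzero image of its determinant into a unit.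
theorem exists_isUnit_det_of_injective [IsLocalRing A] {T : B →ₗ[A] A}
    (hT : ∀ b, algebraMap A K (T b) = Algebra.trace K L (algebraMap B L b))
    {F : Type*} [Field F] (φ : C →+* F) [IsLocalHom (φ.comp (algebraMap A C))]
    (hφ : Function.Injective fun τ : L →ₐ[K] N =>
      φ.comp (galRestrict' A B C τ : B →ₐ[A] C).toRingHom) :
    ∃ (b : (L →ₐ[K] N) → B), IsUnit (Matrix.of fun i j => T (b i * b j)).det := by
  classical
  have hli : LinearIndependent F fun (τ : L →ₐ[K] N) (x : B) => φ (galRestrict' A B C τ x) :=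
    (linearIndependent_monoidHom B F).comp
      (fun τ : L →ₐ[K] N => (φ.comp (galRestrict' A B C τ : B →ₐ[A] C).toRingHom : B →* F))
      fun τ τ' h => hφ (RingHom.ext fun x => DFunLike.congr_fun h x)
  obtain ⟨b, hb⟩ := exists_det_ne_zero_of_linearIndependent hli
  refine ⟨b, isUnit_of_map_unit (φ.comp (algebraMap A C)) _ (isUnit_iff_ne_zero.2 ?_)⟩
  set M : Matrix (L →ₐ[K] N) (L →ₐ[K] N) C := Matrix.of fun τ j => galRestrict' A B C τ (b j)
  have hM : (Matrix.of fun i j => T (b i * b j)).map (algebraMap A C) = M.transpose * M := by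
    ext i j
    refine IsIntegralClosure.algebraMap_injective C A N ?_
    simp only [Matrix.map_apply, Matrix.of_apply, Matrix.mul_apply, Matrix.transpose_apply, M,
      map_sum, map_mul, algebraMap_galRestrict'_apply]
    rw [← IsScalarTower.algebraMap_apply, IsScalarTower.algebraMap_apply A K N, hT,
      trace_eq_sum_embeddings_of_splits hs]
    simp
  have hM' : φ M.det ≠ 0 := by
    rw [RingHom.map_det]
    exact hb
  rw [RingHom.comp_apply, RingHom.map_det, RingHom.mapMatrix_apply, hM, Matrix.det_mul,
    Matrix.det_transpose, map_mul]
  exact mul_ne_zero hM' hM'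

/-- The generators of `B` are packed into one polynomial `s`, so that a single `τ` serves them all.
The norm-like product `P` of the factors `X - τ s` is Galois invariant, hence has coefficients in
the integrally closed ring `A`, and it vanishes at `s`. -/
theorem exists_eq_comp_galRestrict' [Module.Finite A B] [IsGalois K N] {F : Type*} [CommRing F]
    [IsDomain F] (φ : C →+* F) (ψ : B →+* F)
    (h : ψ.comp (algebraMap A B) = φ.comp (algebraMap A C)) :
    ∃ τ : L →ₐ[K] N, ψ = φ.comp (galRestrict' A B C τ : B →ₐ[A] C).toRingHom := by
  classical
  obtain ⟨n, g, hg⟩ := Module.Finite.exists_fin (R := A) (M := B)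
  have hτ₀ : Nonempty (L →ₐ[K] N) := by
    rw [← Fintype.card_pos_iff, AlgHom.card_of_splits _ _ _ hs]
    exact finrank_pos
  obtain ⟨τ₀⟩ := hτ₀
  let t (τ : L →ₐ[K] N) : B →+* C := (galRestrict' A B C τ : B →ₐ[A] C).toRingHom
  have ht : ∀ τ b, algebraMap C N (t τ b) = τ (algebraMap B L b) :=
    fun τ b => algebraMap_galRestrict'_apply A B C τ b
  let s : B[X] := ∑ i, Polynomial.C (g i) * X ^ (i : ℕ)
  have hsi : ∀ i : Fin n, s.coeff i = g i := fun i => by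
    simp [s, Polynomial.coeff_C_mul, Polynomial.coeff_X_pow, Fin.val_inj]
  let P : C[X][X] := ∏ τ : L →ₐ[K] N, (X - Polynomial.C (s.map (t τ)))
  have hP : ∀ i j, (P.coeff i).coeff j ∈ (algebraMap A C).range := by
    intro i j
    have hfix : ∀ σ : N ≃ₐ[K] N, σ (algebraMap C N ((P.coeff i).coeff j)) =
        algebraMap C N ((P.coeff i).coeff j) := fun σ => by
      let γ : C →+* C := (galRestrict' A C C σ.toAlgHom : C →ₐ[A] C).toRingHom
      have hγ : ∀ c, algebraMap C N (γ c) = σ (algebraMap C N c) :=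
        fun c => algebraMap_galRestrict'_apply A C C σ.toAlgHom c
      have hγt : ∀ τ : L →ₐ[K] N, γ.comp (t τ) = t (σ.toAlgHom.comp τ) := fun τ =>
        RingHom.ext fun b => IsIntegralClosure.algebraMap_injective C A N <| by
          rw [RingHom.comp_apply, hγ, ht, ht]
          rfl
      have hPγ : P.map (mapRingHom γ) = P := by
        simp only [P, Polynomial.map_prod]
        refine Fintype.prod_equiv (AlgEquiv.arrowCongr AlgEquiv.refl σ) _ _ fun τ => ?_
        rw [Polynomial.map_sub, Polynomial.map_X, Polynomial.map_C, coe_mapRingHom,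
          Polynomial.map_map, hγt]
        rfl
      have hc := congrArg (fun p => (p.coeff i).coeff j) hPγ
      simp only [Polynomial.coeff_map, coe_mapRingHom] at hc
      rw [← hγ, hc]
    obtain ⟨k, hk⟩ := IntermediateField.mem_bot.1 ((InfiniteGalois.mem_bot_iff_fixed _).2 hfix)
    have hint : IsIntegral A k := by
      rw [← isIntegral_algebraMap_iff (algebraMap K N).injective, hk]
      exact IsIntegralClosure.isIntegral A N ((P.coeff i).coeff j) |>.algebraMap
    obtain ⟨a, rfl⟩ := IsIntegrallyClosed.isIntegral_iff.1 hint
    refine ⟨a, IsIntegralClosure.algebraMap_injective C A N ?_⟩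
    rw [← hk, ← IsScalarTower.algebraMap_apply, ← IsScalarTower.algebraMap_apply]
  have hP' : P ∈ Polynomial.lifts (mapRingHom (algebraMap A C)) := by
    rw [Polynomial.lifts_iff_coeff_lifts]
    intro i
    have : P.coeff i ∈ Polynomial.lifts (algebraMap A C) :=
      (Polynomial.lifts_iff_coeff_lifts _).2 (hP i)
    exact this
  obtain ⟨P₀, hP₀⟩ := (Polynomial.mem_lifts _).1 hP'
  have h0 : P₀.eval₂ (mapRingHom (algebraMap A B)) s = 0 := by
    have hinj : Function.Injective (mapRingHom (t τ₀)) := Polynomial.map_injective _ fun x y h => by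
      refine IsIntegralClosure.algebraMap_injective B A L (τ₀.injective ?_)
      exact (ht τ₀ x).symm.trans ((congrArg _ h).trans (ht τ₀ y))
    refine hinj ?_
    rw [map_zero, Polynomial.hom_eval₂, Polynomial.mapRingHom_comp,
      show (t τ₀).comp (algebraMap A B) = algebraMap A C from
        (galRestrict' A B C τ₀ : B →ₐ[A] C).comp_algebraMap, ← Polynomial.eval_map, hP₀]
    simp only [P, eval_prod]
    exact Finset.prod_eq_zero (Finset.mem_univ τ₀) (by simp)
  -- Applying `ψ` gives `∏ (ψ s - φ (τ s)) = 0` in the domain `F[X]`, so one factor vanishes.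
  have h1 := congrArg (mapRingHom ψ) h0
  rw [map_zero, Polynomial.hom_eval₂, Polynomial.mapRingHom_comp, h, ← Polynomial.mapRingHom_comp,
    ← Polynomial.eval₂_map, hP₀, ← Polynomial.eval_map] at h1
  simp only [P, Polynomial.map_prod, eval_prod, Finset.prod_eq_zero_iff] at h1
  obtain ⟨τ, -, h1⟩ := h1
  refine ⟨τ, ?_⟩
  have h2 : s.map ψ = (s.map (t τ)).map φ := by
    simpa [sub_eq_zero] using h1
  have h3 : ∀ i, ψ (g i) = φ (t τ (g i)) := fun i => by
    have := congrArg (fun p => p.coeff (i : ℕ)) h2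
    simpa [Polynomial.coeff_map, hsi] using this
  ext x
  have hx : x ∈ Submodule.span A (Set.range g) := hg ▸ Submodule.mem_top
  induction hx using Submodule.span_induction with
  | mem x hx =>
    obtain ⟨j, rfl⟩ := hx
    exact h3 j
  | zero => simp
  | add x y _ _ hx hy => rw [map_add, map_add, hx, hy]
  | smul a x _ hx =>
    rw [Algebra.smul_def, map_mul, map_mul, hx]
    congr 1
    rw [← RingHom.comp_apply, h]
    simp

end Conjugates

end TraceRamification

namespace TraceRamification

open Module nonZeroDivisors

/-! ### The trace of an integral closure -/

section LocalTrace

variable {A K L B : Type*} [CommRing A] [IsDomain A] [IsNoetherianRing A] [IsIntegrallyClosed A]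
  [Field K] [Algebra A K] [IsFractionRing A K] [Field L] [Algebra K L] [Algebra A L]
  [IsScalarTower A K L] [FiniteDimensional K L] [Algebra.IsSeparable K L]
  [CommRing B] [Algebra A B] [Algebra B L] [IsScalarTower A B L] [IsIntegralClosure B A L]

omit [IsNoetherianRing A] [IsIntegrallyClosed A] [Algebra.IsSeparable K L] in
variable (A K B) in
theorem exists_algebraMap_eq_smul (y : L) :
    ∃ a : A, a ≠ 0 ∧ ∃ b : B, algebraMap B L b = algebraMap A K a • y := by
  have := IsIntegralClosure.isLocalization A K L B
  obtain ⟨⟨b, ⟨_, a, ha, rfl⟩⟩, h⟩ := IsLocalization.surj (Algebra.algebraMapSubmonoid B A⁰) y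
  refine ⟨a, nonZeroDivisors.ne_zero ha, b, ?_⟩
  rw [← h, Algebra.smul_def, ← IsScalarTower.algebraMap_apply, ← IsScalarTower.algebraMap_apply,
    mul_comm]

omit [IsNoetherianRing A] [IsIntegrallyClosed A] [Algebra.IsSeparable K L] in
theorem span_range_algebraMap_eq_top {ι : Type*} {f : ι → B}
    (hf : Submodule.span A (Set.range f) = ⊤) :
    Submodule.span K (Set.range fun i => algebraMap B L (f i)) = ⊤ := by
  refine eq_top_iff.2 fun y _ => ?_
  obtain ⟨a, ha, b, hb⟩ := exists_algebraMap_eq_smul A K B y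
  have ha' : algebraMap A K a ≠ 0 := by
    rwa [Ne, FaithfulSMul.algebraMap_eq_zero_iff]
  rw [← Submodule.smul_mem_iff _ ha', ← hb]
  clear hb
  have hx : b ∈ Submodule.span A (Set.range f) := hf ▸ Submodule.mem_top
  induction hx using Submodule.span_induction with
  | mem x hx =>
    obtain ⟨j, rfl⟩ := hx
    exact Submodule.subset_span ⟨j, rfl⟩
  | zero => simp
  | add x y _ _ hx hy => rw [map_add]; exact add_mem hx hy
  | smul a x _ hx =>
    rw [Algebra.smul_def, map_mul, ← IsScalarTower.algebraMap_apply,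
      IsScalarTower.algebraMap_apply A K L, ← Algebra.smul_def]
    exact Submodule.smul_mem _ _ hx

variable {T : B →ₗ[A] A}
  (hT : ∀ b, algebraMap A K (T b) = Algebra.trace K L (algebraMap B L b))
include hT

omit [IsNoetherianRing A] [IsIntegrallyClosed A] in
-- Separability makes the trace form of `L/K` nondegenerate, and every element of `L` has a nonzero
-- multiple in `B`.
theorem trace_mul_eq_zero_imp (s : B) (h : ∀ x, T (s * x) = 0) : s = 0 := by
  refine IsIntegralClosure.algebraMap_injective B A L ?_
  rw [map_zero]
  refine (traceForm_nondegenerate K L).1 _ fun y => ?_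
  obtain ⟨a, ha, b, hb⟩ := exists_algebraMap_eq_smul A K B y
  have ha' : algebraMap A K a ≠ 0 := by
    rwa [Ne, FaithfulSMul.algebraMap_eq_zero_iff]
  refine (smul_eq_zero.1 (?_ : algebraMap A K a • Algebra.traceForm K L (algebraMap B L s) y = 0)).resolve_left ha'
  rw [← map_smul, ← hb, Algebra.traceForm_apply, ← map_mul, ← hT, h, map_zero]

omit [IsNoetherianRing A] [IsIntegrallyClosed A] in
theorem isNonSingular_of_isUnit_det {ι : Type*} [Fintype ι] [DecidableEq ι] {b : ι → B}
    (hb : IsUnit (Matrix.of fun i j => T (b i * b j)).det) (hι : Fintype.card ι = finrank K L) :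
    IsNonSingular T ∧ Module.Free A B := by
  obtain ⟨h1, ⟨h2⟩⟩ := isNonSingular_of_isUnit_det_of_forall hb fun s hs =>
    trace_mul_eq_zero_imp hT s fun x => by
      have hu : IsUnit (Matrix.of fun i j =>
          Algebra.trace K L (algebraMap B L (b i) * algebraMap B L (b j))).det := by
        have := hb.map (algebraMap A K)
        rw [RingHom.map_det] at this
        convert this
        ext i j
        simp [hT]
      have hli := linearIndependent_of_isUnit_det hu
      have h0 : Algebra.traceForm K L (algebraMap B L s) = 0 :=
        (basisOfLinearIndependentOfCardEqFinrank' _ hli hι).ext fun i => by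
          simp [Algebra.traceForm_apply, ← map_mul, ← hT, hs]
      refine FaithfulSMul.algebraMap_injective A K ?_
      have := LinearMap.congr_fun h0 (algebraMap B L x)
      rw [Algebra.traceForm_apply, ← map_mul, ← hT] at this
      rw [this, map_zero, LinearMap.zero_apply]
  exact ⟨h1, .of_basis h2⟩

omit [IsNoetherianRing A] [IsIntegrallyClosed A] in
theorem isNonSingular_of_injective [IsLocalRing A] {N C : Type*} [Field N] [Algebra K N]
    [Algebra A N] [IsScalarTower A K N] [CommRing C] [Algebra A C] [Algebra C N]
    [IsScalarTower A C N] [IsIntegralClosure C A N]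
    (hs : ∀ x : L, ((minpoly K x).map (algebraMap K N)).Splits)
    {F : Type*} [Field F] (φ : C →+* F) [IsLocalHom (φ.comp (algebraMap A C))]
    (hφ : Function.Injective fun τ : L →ₐ[K] N =>
      φ.comp (galRestrict' A B C τ : B →ₐ[A] C).toRingHom) :
    IsNonSingular T ∧ Module.Free A B := by
  classical
  obtain ⟨b, hb⟩ := exists_isUnit_det_of_injective hs hT φ hφ
  refine isNonSingular_of_isUnit_det hT (b := b) (by convert hb) (AlgHom.card_of_splits _ _ _ hs)

open IsLocalRing TensorProduct in
-- Counting: the `r ≥ [L:K]` distinct points `B → F` lift to distinct embeddings `L → N`, of which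
-- there are only `[L:K]`. Hence every embedding occurs and their reductions are distinct.
theorem isNonSingular_of_formallyUnramified_of_algHom [IsLocalRing A]
    [Algebra.FormallyUnramified A B] {N C : Type*} [Field N] [Algebra K N] [IsGalois K N]
    [Algebra A N] [IsScalarTower A K N] [CommRing C] [Algebra A C] [Algebra C N]
    [IsScalarTower A C N] [IsIntegralClosure C A N]
    (hs : ∀ x : L, ((minpoly K x).map (algebraMap K N)).Splits)
    {F : Type*} [Field F] [IsSepClosed F] [Algebra A F] [hF : IsLocalHom (algebraMap A F)]
    (φ : C →ₐ[A] F) : IsNonSingular T ∧ Module.Free A B := by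
  have hfin : Module.Finite A B := IsIntegralClosure.finite A K L B
  let : Algebra (ResidueField A) F := (ResidueField.lift (algebraMap A F)).toAlgebra
  have : IsScalarTower A (ResidueField A) F := .of_algebraMap_eq fun a => rfl
  have := Algebra.FormallyEtale.of_formallyUnramified_of_field F (F ⊗[A] B)
  obtain ⟨r, ⟨e⟩⟩ := Algebra.IsFiniteSplit.nonempty_algEquiv_fun F (F ⊗[A] B)
  -- `r` is the dimension of `B/𝔪B`. By Nakayama that many elements generate `B` over `A`, hence
  -- span `L` over `K`.
  have hr : finrank K L ≤ r := by
    let w := Free.chooseBasis (ResidueField A) (ResidueField A ⊗[A] B)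
    obtain ⟨f, hf⟩ := (TensorProduct.mk_surjective A B (ResidueField A)
      Ideal.Quotient.mk_surjective).comp_left w
    have hspan := span_eq_top_of_tmul_eq_basis f w (congrFun hf)
    have h1 : r = Fintype.card (Free.ChooseBasisIndex (ResidueField A) (ResidueField A ⊗[A] B)) := by
      rw [← finrank_eq_card_basis w, ← finrank_baseChange (R := F),
        (Algebra.TensorProduct.cancelBaseChange A (ResidueField A) F F B).toLinearEquiv.finrank_eq,
        e.toLinearEquiv.finrank_eq, finrank_fin_fun]
    rw [h1]
    exact finrank_le_of_span_eq_top (span_range_algebraMap_eq_top (K := K) (L := L) hspan)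
  let ψ (i : Fin r) : B →ₐ[A] F := (((Pi.evalAlgHom F (fun _ => F) i).comp e.toAlgHom).restrictScalars A).comp
    Algebra.TensorProduct.includeRight
  have hψ : Function.Injective ψ := fun i j hij => by
    have h1 : (Pi.evalAlgHom F (fun _ => F) i).comp e.toAlgHom =
        (Pi.evalAlgHom F (fun _ => F) j).comp e.toAlgHom :=
      Algebra.TensorProduct.ext' fun c b => by
        have := AlgHom.congr_fun hij b
        rw [← mul_one c, ← smul_eq_mul, ← TensorProduct.smul_tmul', map_smul, map_smul]
        exact congrArg (c • ·) this
    by_contra hne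
    have := AlgHom.congr_fun h1 (e.symm (Pi.single i 1))
    simp [hne] at this
  have hex : ∀ i, ∃ τ : L →ₐ[K] N,
      (ψ i).toRingHom = φ.toRingHom.comp (galRestrict' A B C τ : B →ₐ[A] C).toRingHom := fun i =>
    exists_eq_comp_galRestrict' hs φ.toRingHom _
      ((ψ i).comp_algebraMap.trans φ.comp_algebraMap.symm)
  choose τ hτ using hex
  have hτi : Function.Injective τ := fun i j hij => hψ <| AlgHom.ext fun b => by
    have := RingHom.congr_fun ((hτ i).trans (hij ▸ (hτ j).symm)) b
    exact this
  have hτb : Function.Bijective τ := (Fintype.bijective_iff_injective_and_card τ).2 ⟨hτi,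
    le_antisymm (Fintype.card_le_of_injective τ hτi) (by
      rwa [AlgHom.card_of_splits _ _ _ hs, Fintype.card_fin])⟩
  have : IsLocalHom (φ.toRingHom.comp (algebraMap A C)) := φ.comp_algebraMap.symm ▸ hF
  refine isNonSingular_of_injective hT hs φ.toRingHom fun τ₁ τ₂ h => ?_
  obtain ⟨i, rfl⟩ := hτb.2 τ₁
  obtain ⟨j, rfl⟩ := hτb.2 τ₂
  simp only [← hτ] at h
  rw [hψ (AlgHom.ext fun b => RingHom.congr_fun h b)]

open IsLocalRing in
-- The reduction is modulo a prime `q` above 𝔪 in the integral closure of `A` in a separable closure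
-- of `K`. Only integrality of that ring is needed.
theorem isNonSingular_of_formallyUnramified [IsLocalRing A] [Algebra.FormallyUnramified A B] :
    IsNonSingular T ∧ Module.Free A B := by
  let N := SeparableClosure K
  let C := integralClosure A N
  have hs : ∀ x : L, ((minpoly K x).map (algebraMap K N)).Splits := fun x =>
    IsSepClosed.splits_of_separable _ (Polynomial.Separable.map
      (Algebra.IsSeparable.isSeparable K x))
  have hinj : FaithfulSMul A C := by
    rw [faithfulSMul_iff_algebraMap_injective]
    refine Function.Injective.of_comp (f := algebraMap C N) ?_
    rw [← RingHom.coe_comp, ← IsScalarTower.algebraMap_eq, IsScalarTower.algebraMap_eq A K N]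
    exact (algebraMap K N).injective.comp (IsFractionRing.injective A K)
  obtain ⟨q, hq, hqm⟩ := Ideal.exists_ideal_over_maximal_of_isIntegral (S := C) (maximalIdeal A)
    (by simp [(RingHom.injective_iff_ker_eq_bot _).mp (FaithfulSMul.algebraMap_injective A C)])
  let := Ideal.Quotient.field q
  have hloc : IsLocalHom (algebraMap A (AlgebraicClosure (C ⧸ q))) := ⟨fun a ha => by
    by_contra hna
    have h1 : algebraMap A C a ∈ q := by
      rw [← Ideal.mem_comap, hqm]
      exact hna
    rw [IsScalarTower.algebraMap_apply A (C ⧸ q), IsScalarTower.algebraMap_apply A C (C ⧸ q),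
      Ideal.Quotient.algebraMap_eq, Ideal.Quotient.eq_zero_iff_mem.2 h1, map_zero] at ha
    exact not_isUnit_zero ha⟩
  exact isNonSingular_of_formallyUnramified_of_algHom hT hs
    (((Algebra.ofId (C ⧸ q) (AlgebraicClosure (C ⧸ q))).restrictScalars A).comp
      (Ideal.Quotient.mkₐ A q))

/-- Both traces become that of `L/K` after inverting `A⁰`. -/
theorem eq_trace [Module.Free A B] : T = Algebra.trace A B := by
  have := IsIntegralClosure.finite A K L B
  have := IsIntegralClosure.isLocalization A K L B
  ext b
  refine FaithfulSMul.algebraMap_injective A K ?_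
  rw [hT, Algebra.trace_localization A A⁰]

end LocalTrace

end TraceRamification

namespace TraceRamification

open Module nonZeroDivisors

section LocalTrace

variable {A B : Type*} [CommRing A] [IsNoetherianRing A] [CommRing B] [Algebra A B]
  [Module.Finite A B]

theorem IsNonSingular.formallyEtale [Module.Free A B] (hT : IsNonSingular (Algebra.trace A B)) :
    Algebra.FormallyEtale A B := by
  have := hT.formallyUnramified
  have := Algebra.FinitePresentation.of_finiteType.1 (inferInstance : Algebra.FiniteType A B)
  have := Algebra.Etale.of_formallyUnramified_of_flat (R := A) (S := B)
  infer_instance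

end LocalTrace

/-! ### Passage to the localization at 𝔭 -/

section Localization

variable {R S : Type*} [CommRing R] [CommRing S] [Algebra R S] (p : Ideal R) [p.IsPrime]

theorem exists_smul_eq_algebraMap (b : LocAt S p) : ∃ (t : p.primeCompl) (s : S),
    algebraMap R (Localization.AtPrime p) t • b = algebraMap S (LocAt S p) s := by
  obtain ⟨⟨s, ⟨_, t, ht, rfl⟩⟩, h⟩ :=
    IsLocalization.surj (Algebra.algebraMapSubmonoid S p.primeCompl) b
  refine ⟨⟨t, ht⟩, s, ?_⟩
  rw [← h, algebraMap_smul, Algebra.smul_def, mul_comm,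
    IsScalarTower.algebraMap_apply R S (LocAt S p)]

theorem isIntegral_locAt [Algebra.IsIntegral R S] :
    Algebra.IsIntegral (Localization.AtPrime p) (LocAt S p) :=
  ⟨isIntegral_localization (M := p.primeCompl)⟩

theorem under_liesOver_of_isMaximal [Algebra.IsIntegral R S] (Q : Ideal (LocAt S p)) [Q.IsMaximal] :
    (Q.comap (algebraMap S (LocAt S p))).LiesOver p := by
  have : Algebra.IsIntegral (Localization.AtPrime p) (LocAt S p) := isIntegral_locAt p
  have h := IsLocalRing.eq_maximalIdeal
    (Ideal.isMaximal_comap_of_isIntegral_of_isMaximal (R := Localization.AtPrime p) Q)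
  constructor
  rw [Ideal.under_def, Ideal.comap_comap, ← IsScalarTower.algebraMap_eq,
    IsScalarTower.algebraMap_eq R (Localization.AtPrime p), ← Ideal.comap_comap, h]
  exact Localization.AtPrime.under_maximalIdeal.symm

theorem exists_comap_eq_of_liesOver (q : Ideal S) [q.IsPrime] [q.LiesOver p] :
    ∃ Q : Ideal (LocAt S p), Q.IsPrime ∧ q = Q.comap (algebraMap S (LocAt S p)) := by
  have hd : Disjoint (Algebra.algebraMapSubmonoid S p.primeCompl : Set S) q := by
    rw [Set.disjoint_left]
    rintro _ ⟨x, hx, rfl⟩ hxq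
    refine hx ?_
    rw [q.over_def p]
    exact hxq
  exact ⟨q.map (algebraMap S (LocAt S p)), IsLocalization.isPrime_of_isPrime_disjoint _ _ _ ‹_› hd,
    (IsLocalization.under_map_of_isPrime_disjoint _ _ ‹_› hd).symm⟩

/-- Maximal ideals of `S_𝔭` lie over 𝔭, so the hypothesis covers them. The other primes follow
because the ramified locus is the support of the differentials, which is stable under
specialization. -/
theorem IsUnramifiedOver.formallyUnramified [Algebra.IsIntegral R S]
    (h : IsUnramifiedOver S p) :
    Algebra.FormallyUnramified (Localization.AtPrime p) (LocAt S p) := by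
  suffices Algebra.FormallyUnramified R (LocAt S p) from .of_restrictScalars R _ _
  rw [← Algebra.unramifiedLocus_eq_univ_iff, Set.eq_univ_iff_forall]
  intro Q
  obtain ⟨Q', hQ', hle⟩ := Q.asIdeal.exists_le_maximal Q.2.ne_top
  have h1 : (⟨Q', hQ'.isPrime⟩ : PrimeSpectrum _) ∈ Algebra.unramifiedLocus R (LocAt S p) := by
    have := h _ (under_liesOver_of_isMaximal p Q')
    exact Algebra.FormallyUnramified.of_equiv
      ((IsLocalization.localizationLocalizationAtPrimeIsoLocalization
        (Algebra.algebraMapSubmonoid S p.primeCompl) Q').restrictScalars R)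
  rw [Algebra.unramifiedLocus_eq_compl_support] at h1 ⊢
  exact fun hQ => h1 (Module.mem_support_mono hle hQ)

theorem isEtaleOver_of_formallyEtale
    [Algebra.FormallyEtale (Localization.AtPrime p) (LocAt S p)] : IsEtaleOver S p := by
  intro q hq hqp
  obtain ⟨Q, hQ, rfl⟩ := exists_comap_eq_of_liesOver p q
  have : Algebra.FormallyEtale R (Localization.AtPrime p) := .of_isLocalization p.primeCompl
  have : Algebra.FormallyEtale R (LocAt S p) := .comp R (Localization.AtPrime p) _
  have : Algebra.FormallyEtale (LocAt S p) (Localization.AtPrime Q) :=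
    .of_isLocalization Q.primeCompl
  have : Algebra.FormallyEtale R (Localization.AtPrime Q) := .comp R (LocAt S p) _
  exact Algebra.FormallyEtale.of_equiv
      ((IsLocalization.localizationLocalizationAtPrimeIsoLocalization
        (Algebra.algebraMapSubmonoid S p.primeCompl) Q).restrictScalars R).symm

omit [p.IsPrime] in
theorem IsEtaleOver.isUnramifiedOver (h : IsEtaleOver S p) : IsUnramifiedOver S p := fun q _ hq =>
  have := h q hq
  inferInstanceAs (Algebra.FormallyUnramified R (Localization.AtPrime q))

/-- Denominators become units of `R_𝔭`, and the maximal ideal of `R_𝔭` contracts to 𝔭, so no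
finiteness is required. -/
theorem map_transposeIdeal (T : S →ₗ[R] R) :
    (transposeIdeal T p).map (algebraMap S (LocAt S p)) =
      transposeIdeal (locHom p T) (IsLocalRing.maximalIdeal (Localization.AtPrime p)) := by
  have hu : ∀ t : p.primeCompl, IsUnit (algebraMap R (Localization.AtPrime p) t) :=
    IsLocalization.map_units _
  refine le_antisymm (Ideal.map_le_iff_le_comap.2 fun s hs b => ?_) fun b hb => ?_
  · obtain ⟨t, x, h⟩ := exists_smul_eq_algebraMap p b
    rw [← Ideal.unit_mul_mem_iff_mem _ (hu t), ← smul_eq_mul, ← map_smul, ← mul_smul_comm, h,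
      ← map_mul, locHom_algebraMap, IsLocalization.AtPrime.to_map_mem_maximal_iff _ p]
    exact hs x
  · obtain ⟨t, s, h⟩ := exists_smul_eq_algebraMap p b
    have hs : s ∈ transposeIdeal T p := fun x => by
      rw [← IsLocalization.AtPrime.to_map_mem_maximal_iff (Localization.AtPrime p) p,
        ← locHom_algebraMap, map_mul, ← h, smul_mul_assoc, map_smul]
      exact Ideal.mul_mem_left _ _ (hb _)
    have h1 := Ideal.mem_map_of_mem (algebraMap S (LocAt S p)) hs
    rw [← h, Algebra.smul_def] at h1
    exact (Ideal.unit_mul_mem_iff_mem _ ((hu t).map _)).1 h1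

theorem map_eq_map_maximalIdeal :
    p.map (algebraMap R (LocAt S p)) = (IsLocalRing.maximalIdeal (Localization.AtPrime p)).map
      (algebraMap (Localization.AtPrime p) (LocAt S p)) := by
  rw [← Localization.AtPrime.map_eq_maximalIdeal, Ideal.map_map, ← IsScalarTower.algebraMap_eq]

theorem map_le_transposeIdeal (T : S →ₗ[R] R) (a : Ideal R) :
    a.map (algebraMap R S) ≤ transposeIdeal T a :=
  Ideal.map_le_iff_le_comap.2 fun x hx y => by
    rw [← Algebra.smul_def, map_smul]
    exact a.mul_mem_right _ hx

end Localization

/-! ### The localized trace and inertia -/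

section Normalization

variable {R K L S : Type*} [CommRing R] [IsDomain R] [IsIntegrallyClosed R] [Field K] [Algebra R K]
  [IsFractionRing R K] [Field L] [Algebra K L] [FiniteDimensional K L]
  [Algebra R L] [IsScalarTower R K L] [CommRing S] [Algebra R S] [Algebra S L]
  [IsScalarTower R S L] [IsIntegralClosure S R L] (p : Ideal R) [p.IsPrime]

variable (R K L S) in
-- The continuation form supplies `K` and `L` with compatible algebra structures over `R_𝔭` and
-- `S_𝔭`, so that results about an integral closure over a local base apply.
theorem localized_trace_induction {motive : Prop}
    (h : ∀ [Algebra (Localization.AtPrime p) K] [IsScalarTower R (Localization.AtPrime p) K]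
      [IsFractionRing (Localization.AtPrime p) K]
      [Algebra (Localization.AtPrime p) L] [IsScalarTower (Localization.AtPrime p) K L]
      [Algebra (LocAt S p) L] [IsScalarTower S (LocAt S p) L]
      [IsScalarTower (Localization.AtPrime p) (LocAt S p) L]
      [IsIntegralClosure (LocAt S p) (Localization.AtPrime p) L],
      (∀ b, algebraMap (Localization.AtPrime p) K (locHom p (traceHom R K L S) b) =
        Algebra.trace K L (algebraMap (LocAt S p) L b)) → motive) : motive := by
  have hle : p.primeCompl ≤ R⁰ := p.primeCompl_le_nonZeroDivisors
  let : Algebra (Localization.AtPrime p) K :=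
    IsLocalization.localizationAlgebraOfSubmonoidLe (Localization.AtPrime p) K p.primeCompl R⁰ hle
  have : IsScalarTower R (Localization.AtPrime p) K :=
    IsLocalization.localization_isScalarTower_of_submonoid_le _ _ p.primeCompl R⁰ hle
  have : IsFractionRing (Localization.AtPrime p) K :=
    IsFractionRing.isFractionRing_of_isDomain_of_isLocalization p.primeCompl _ _
  let : Algebra (Localization.AtPrime p) L :=
    ((algebraMap K L).comp (algebraMap (Localization.AtPrime p) K)).toAlgebra
  have : IsScalarTower (Localization.AtPrime p) K L := .of_algebraMap_eq fun _ => rfl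
  have : IsScalarTower R (Localization.AtPrime p) L := .to₁₂₄ R (Localization.AtPrime p) K L
  have hunit : ∀ y : Algebra.algebraMapSubmonoid S p.primeCompl, IsUnit (algebraMap S L y) := by
    rintro ⟨_, t, ht, rfl⟩
    rw [← IsScalarTower.algebraMap_apply, IsScalarTower.algebraMap_apply R K L, isUnit_iff_ne_zero]
    simpa using nonZeroDivisors.ne_zero (hle ht)
  let : Algebra (LocAt S p) L := (IsLocalization.lift hunit).toAlgebra
  have hSB : IsScalarTower S (LocAt S p) L := .of_algebraMap_eq fun s =>
    (IsLocalization.lift_eq hunit s).symm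
  have : IsScalarTower R (LocAt S p) L := .to₁₃₄ R S (LocAt S p) L
  have : IsScalarTower (Localization.AtPrime p) (LocAt S p) L := by
    refine .of_algebraMap_eq' (IsLocalization.ringHom_ext p.primeCompl ?_)
    rw [RingHom.comp_assoc, ← IsScalarTower.algebraMap_eq, ← IsScalarTower.algebraMap_eq,
      IsScalarTower.algebraMap_eq R S (LocAt S p), ← RingHom.comp_assoc,
      ← IsScalarTower.algebraMap_eq S, ← IsScalarTower.algebraMap_eq]
  have : IsIntegralClosure (LocAt S p) (Localization.AtPrime p) L := by
    have hint : Algebra.IsIntegral R S := IsIntegralClosure.isIntegral_algebra R L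
    have hint' := isIntegral_locAt (S := S) p
    have hu : ∀ t : p.primeCompl, IsUnit (algebraMap R (Localization.AtPrime p) t) :=
      IsLocalization.map_units _
    refine ⟨(injective_iff_map_eq_zero _).2 fun b hb => ?_, fun {y} => ⟨fun hy => ?_, ?_⟩⟩
    · obtain ⟨t, s, h⟩ := exists_smul_eq_algebraMap p b
      have h1 := congrArg (algebraMap (LocAt S p) L) h
      rw [← IsScalarTower.algebraMap_apply, Algebra.smul_def, map_mul, hb, mul_zero] at h1
      have h2 : s = 0 := IsIntegralClosure.algebraMap_injective S R L (by rw [← h1, map_zero])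
      rwa [h2, map_zero, (hu t).smul_eq_zero] at h
    · obtain ⟨t, ht⟩ := hy.exists_multiple_integral_of_isLocalization p.primeCompl y
      obtain ⟨s, hs⟩ := IsIntegralClosure.isIntegral_iff (A := S).1 ht
      obtain ⟨u, hu⟩ := hu t
      refine ⟨(↑u⁻¹ : Localization.AtPrime p) • algebraMap S (LocAt S p) s, ?_⟩
      rw [Algebra.smul_def, map_mul, ← IsScalarTower.algebraMap_apply,
        ← IsScalarTower.algebraMap_apply, hs, ← Algebra.smul_def, Submonoid.smul_def,
        ← algebraMap_smul (Localization.AtPrime p) (t : R) y, ← hu, smul_smul, Units.inv_mul, one_smul]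
    · rintro ⟨b, rfl⟩
      exact (Algebra.IsIntegral.isIntegral b).algebraMap
  refine h fun b => ?_
  obtain ⟨t, s, hts⟩ := exists_smul_eq_algebraMap p b
  have ht : algebraMap R K t ≠ 0 := by simpa using nonZeroDivisors.ne_zero (hle t.2)
  refine smul_right_injective K ht ?_
  have h1 := congrArg (fun b => algebraMap (Localization.AtPrime p) K
    (locHom p (traceHom R K L S) b)) hts
  have h2 := congrArg (fun b => Algebra.trace K L (algebraMap (LocAt S p) L b)) hts
  simp only [locHom_algebraMap, map_smul, ← IsScalarTower.algebraMap_apply,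
    algebraMap_traceHom, smul_eq_mul, map_mul] at h1
  simp only [Algebra.smul_def, map_mul, ← IsScalarTower.algebraMap_apply] at h2
  rw [IsScalarTower.algebraMap_apply R K L, ← Algebra.smul_def, map_smul] at h2
  exact h1.trans h2.symm

omit [IsDomain R] [IsIntegrallyClosed R] in
-- An inertia element induces an endomorphism of `S_q` that is the identity on the residue field.
-- Unramifiedness lifts this equality to all powers of the maximal ideal, and their intersection is
-- zero.
theorem inertiaGroup_eq_bot_of_isUnramifiedAt [IsNoetherianRing S] (q : Ideal S) [q.IsPrime]
    [hq : Algebra.IsUnramifiedAt R q] : inertiaGroup R K L S q = ⊥ := by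
  have : IsDomain S := (IsIntegralClosure.equiv R S L (integralClosure R L)).toMulEquiv.isDomain _
  refine (Subgroup.eq_bot_iff_forall _).2 fun σ hσ => ?_
  have hσ' := (mem_inertiaGroup R K L S).1 hσ
  have hcomap : q = q.comap (galRestrict R K L S σ) := by
    refine Ideal.ext fun s => ?_
    rw [Ideal.mem_comap, ← Ideal.add_mem_iff_right q (hσ' s), sub_add_cancel]
  let g : Localization.AtPrime q →ₐ[R] Localization.AtPrime q :=
    { Localization.localRingHom q q (galRestrict R K L S σ : S →+* S) hcomap with
      commutes' := fun r => by
        rw [IsScalarTower.algebraMap_apply R S]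
        exact (Localization.localRingHom_to_map q q _ hcomap _).trans (by simp) }
  have hg : ∀ s : S, g (algebraMap S _ s) = algebraMap S _ (galRestrict R K L S σ s) := fun s =>
    Localization.localRingHom_to_map q q _ hcomap s
  have key : g = AlgHom.id R _ := by
    refine Algebra.FormallyUnramified.ext_of_iInf (I := IsLocalRing.maximalIdeal _)
      (Ideal.iInf_pow_eq_bot_of_isLocalRing (IsLocalRing.maximalIdeal _)
        (IsLocalRing.maximalIdeal.isMaximal _).ne_top) fun x => ?_
    have : (Ideal.Quotient.mk (IsLocalRing.maximalIdeal (Localization.AtPrime q))).comp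
        g.toRingHom = Ideal.Quotient.mk _ := by
      refine IsLocalization.ringHom_ext q.primeCompl (RingHom.ext fun s => ?_)
      refine Ideal.Quotient.eq.2 ?_
      change g (algebraMap S _ s) - _ ∈ _
      rw [hg, ← map_sub, IsLocalization.AtPrime.to_map_mem_maximal_iff _ q]
      exact hσ' s
    exact RingHom.congr_fun this x
  refine (galRestrict R K L S).injective (AlgEquiv.ext fun s => ?_)
  refine IsLocalization.injective (Localization.AtPrime q) q.primeCompl_le_nonZeroDivisors ?_
  rw [← hg, key, map_one]
  rfl

/-- Here `N = L`, `C = B`, and the reduction is to the residue field at `Q`. If `σ₁` and `σ₂` have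
equal reductions, evaluating at `σ₂⁻¹ s` puts `σ₁ σ₂⁻¹` in the inertia group. -/
theorem isNonSingular_of_inertiaGroup_eq_bot [IsGalois K L] (q : Ideal S) [q.IsPrime]
    [q.LiesOver p] (h : inertiaGroup R K L S q = ⊥) :
    IsNonSingular (locHom p (traceHom R K L S)) ∧
      Module.Free (Localization.AtPrime p) (LocAt S p) := by
  refine localized_trace_induction R K L S p ?_
  intro _ _ _ _ _ _ _ _ _ hT
  obtain ⟨Q, hQ, rfl⟩ := exists_comap_eq_of_liesOver p q
  have hφ : IsLocalHom ((algebraMap (LocAt S p) Q.ResidueField).comp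
      (algebraMap (Localization.AtPrime p) (LocAt S p))) := ⟨fun a ha => by
    have hle : IsLocalRing.maximalIdeal (Localization.AtPrime p) ≤
        Q.comap (algebraMap (Localization.AtPrime p) (LocAt S p)) := by
      rw [← Localization.AtPrime.map_eq_maximalIdeal, Ideal.map_le_iff_le_comap,
        Ideal.comap_comap, ← IsScalarTower.algebraMap_eq, IsScalarTower.algebraMap_eq R S,
        ← Ideal.comap_comap]
      exact ((Q.comap (algebraMap S (LocAt S p))).over_def p).le
    by_contra hna
    have h1 : algebraMap (Localization.AtPrime p) (LocAt S p) a ∈ Q := hle hna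
    rw [RingHom.comp_apply, Ideal.algebraMap_residueField_eq_zero.2 h1] at ha
    exact not_isUnit_zero ha⟩
  refine isNonSingular_of_injective hT (N := L) (C := LocAt S p)
    (fun x => Normal.splits inferInstance x) (algebraMap (LocAt S p) Q.ResidueField)
    fun τ₁ τ₂ h12 => ?_
  obtain ⟨σ₁, rfl⟩ := (algEquivEquivAlgHom K L).surjective τ₁
  obtain ⟨σ₂, rfl⟩ := (algEquivEquivAlgHom K L).surjective τ₂
  have hgal : ∀ (σ : Gal(L/K)) (s : S),
      galRestrict' (Localization.AtPrime p) (LocAt S p) (LocAt S p) (σ : L →ₐ[K] L)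
        (algebraMap S (LocAt S p) s) = algebraMap S (LocAt S p) (galRestrict R K L S σ s) :=
    fun σ s => by
      refine IsIntegralClosure.algebraMap_injective _ (Localization.AtPrime p) L ?_
      rw [algebraMap_galRestrict'_apply, ← IsScalarTower.algebraMap_apply,
        ← IsScalarTower.algebraMap_apply, algebraMap_galRestrict_apply]
      rfl
  have h1 : σ₁ * σ₂⁻¹ ∈ inertiaGroup R K L S (Q.comap (algebraMap S (LocAt S p))) := by
    refine (mem_inertiaGroup R K L S).2 fun s => ?_
    have h2 := RingHom.congr_fun h12 (algebraMap S (LocAt S p) (galRestrict R K L S σ₂⁻¹ s))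
    have h3 : algebraMap (LocAt S p) Q.ResidueField
          (algebraMap S _ (galRestrict R K L S σ₁ (galRestrict R K L S σ₂⁻¹ s))) =
        algebraMap (LocAt S p) Q.ResidueField
          (algebraMap S _ (galRestrict R K L S σ₂ (galRestrict R K L S σ₂⁻¹ s))) := by
      rw [← hgal σ₁, ← hgal σ₂]
      exact h2
    rw [← AlgEquiv.mul_apply, ← AlgEquiv.mul_apply, ← map_mul, ← map_mul, mul_inv_cancel, map_one,
      AlgEquiv.one_apply, ← sub_eq_zero, ← map_sub, ← map_sub,
      Ideal.algebraMap_residueField_eq_zero] at h3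
    exact h3
  rw [h, Subgroup.mem_bot, mul_inv_eq_one] at h1
  rw [h1]

end Normalization

end TraceRamification

open TraceRamification in
theorem mainTheorem10 (R K L S : Type*) [CommRing R] [IsDomain R] [IsNoetherianRing R]
    [IsIntegrallyClosed R] [Field K] [Algebra R K] [IsFractionRing R K]
    [Field L] [Algebra K L] [FiniteDimensional K L] [Algebra.IsSeparable K L]
    [Algebra R L] [IsScalarTower R K L]
    [CommRing S] [Algebra R S] [Algebra S L] [IsScalarTower R S L] [IsIntegralClosure S R L]
    (p : Ideal R) [p.IsPrime] :
    List.TFAE [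
      TraceRamification.IsEtaleOver S p,
      TraceRamification.IsUnramifiedOver S p,
      TraceRamification.RamIsZero
          (TraceRamification.locHom p (TraceRamification.traceHom R K L S)) ∧
        Module.Flat (Localization.AtPrime p) (TraceRamification.LocAt S p),
      TraceRamification.IsNonSingular
          (TraceRamification.locHom p (TraceRamification.traceHom R K L S)) ∧
        Module.Flat (Localization.AtPrime p) (TraceRamification.LocAt S p),
      p.map (algebraMap R (TraceRamification.LocAt S p)) =
        (TraceRamification.transposeIdeal (TraceRamification.traceHom R K L S) p).map
          (algebraMap S (TraceRamification.LocAt S p))] ∧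
    (IsGalois K L →
      (TraceRamification.IsEtaleOver S p ↔
        TraceRamification.ramificationIndex R K L S p = 1)) := by
  refine TraceRamification.localized_trace_induction R K L S p ?_
  intro _ _ _ _ _ _ _ _ _ hT
  have : Algebra.IsIntegral R S := IsIntegralClosure.isIntegral_algebra R L
  have : IsNoetherianRing S := IsIntegralClosure.isNoetherianRing R K L S
  have : IsNoetherianRing (Localization.AtPrime p) :=
    IsLocalization.isNoetherianRing p.primeCompl _ inferInstance
  have : IsIntegrallyClosed (Localization.AtPrime p) :=
    isIntegrallyClosed_of_isLocalization _ p.primeCompl p.primeCompl_le_nonZeroDivisors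
  have : Module.Finite (Localization.AtPrime p) (TraceRamification.LocAt S p) :=
    IsIntegralClosure.finite (Localization.AtPrime p) K L _
  have : IsDomain (TraceRamification.LocAt S p) :=
    (IsIntegralClosure.algebraMap_injective (TraceRamification.LocAt S p)
      (Localization.AtPrime p) L).isDomain
  have hnd := TraceRamification.trace_mul_eq_zero_imp (K := K) (L := L) hT
  have hfree : Module.Flat (Localization.AtPrime p) (TraceRamification.LocAt S p) →
      Module.Free (Localization.AtPrime p) (TraceRamification.LocAt S p) := fun _ =>
    Module.free_of_flat_of_isLocalRing
  have h12 : IsEtaleOver S p → IsUnramifiedOver S p := IsEtaleOver.isUnramifiedOver p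
  have h41 : IsNonSingular (locHom p (traceHom R K L S)) ∧
      Module.Flat (Localization.AtPrime p) (LocAt S p) → IsEtaleOver S p := fun ⟨h, hf⟩ => by
    have := hfree hf
    rw [eq_trace hT] at h
    have := h.formallyEtale
    exact isEtaleOver_of_formallyEtale p
  refine ⟨?_, fun _ => ⟨fun h => ?_, fun h => ?_⟩⟩
  · tfae_have 1 → 2 := h12
    tfae_have 2 → 4 := fun h => by
      have := h.formallyUnramified p
      obtain ⟨h1, h2⟩ := isNonSingular_of_formallyUnramified hT
      exact ⟨h1, inferInstance⟩
    tfae_have 4 → 1 := h41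
    tfae_have 4 → 3 := fun h => ⟨h.1.ramIsZero, h.2⟩
    tfae_have 3 → 4 := fun ⟨h, hf⟩ => by
      have := hfree hf
      exact ⟨isNonSingular_of_ramIsZero hnd h, hf⟩
    tfae_have 4 → 5 := fun ⟨h, hf⟩ => by
      have := hfree hf
      rw [map_transposeIdeal, map_eq_map_maximalIdeal]
      exact le_antisymm (map_le_transposeIdeal _ _) (h.transposeIdeal_le _)
    tfae_have 5 → 4 := fun h => by
      rw [map_transposeIdeal, map_eq_map_maximalIdeal] at h
      obtain ⟨h1, h2⟩ := isNonSingular_of_transposeIdeal_le hnd h.ge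
      exact ⟨h1, inferInstance⟩
    tfae_finish
  · obtain ⟨q, hq, hqp⟩ := exists_prime_over R K L S p
    rw [ramificationIndex_eq R K L S p q, ← Subgroup.eq_bot_iff_card]
    have := h12 h q hqp
    exact inertiaGroup_eq_bot_of_isUnramifiedAt q
  · obtain ⟨q, hq, hqp⟩ := exists_prime_over R K L S p
    rw [ramificationIndex_eq R K L S p q, ← Subgroup.eq_bot_iff_card] at h
    obtain ⟨h1, h2⟩ := isNonSingular_of_inertiaGroup_eq_bot p q h
    exact h41 ⟨h1, inferInstance⟩
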